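/- Let $a<b$ and $c<d$ be real numbers and let $(a_n)_{n\ge 0}$ be a strictly increasing sequence of reals with $a_0=a$ and $\lim_{n\to\infty}a_n=b$ (for example $a_n=a+\frac{b-a}{2}+\dots+\frac{b-a}{2^n}$). Let $\varphi:[a_0,a_1]\times[c,d]\to\mathbb{R}$ be a continuous function with $\varphi(a_0,y)=\varphi(a_1,y)$ for all $y\in[c,d]$. For $n\ge 1$ let $$\psi_n(x)=\frac{(a_1-a_0)x+a_0a_n-a_1a_{n-1}}{a_n-a_{n-1}}$$ be the increasing affine map of $[a_{n-1},a_n]$ onto $[a_0,a_1]$. Put $F_1=\varphi$ and, for $n\ge 2$ and $(x,y)\in[a_{n-1},a_n]\times[c,d]$, $$F_n(x,y)=\frac1n\,\varphi(\psi_n(x),y)+\frac{n-1}{n}\,\varphi(a_0,y).$$ For $n\ge1$ define $T_n:[a,b]\times[c,d]\to\mathbb{R}$ by $T_n(x,y)=F_k(x,y)$ if $x\in[a_{k-1},a_k]$ with $1\le k\le n$, and $T_n(x,y)=F_n(a_n,y)$ if $x\in[a_n,b]$. Suppose that $\varphi$ is of bounded variation in the sense of Arzelà on $[a_0,a_1]\times[c,d]$,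 that is, the sums $$\sum_{i=0}^{m-1}|\varphi(x_{i+1},y_{i+1})-\varphi(x_i,y_i)|$$ are bounded uniformly over all $m$ and all chains $a_0=x_0\le x_1\le\dots\le x_m=a_1$ and $c=y_0\le y_1\le\dots\le y_m=d$. Then the limit $T(x,y)=\lim_{n\to\infty}T_n(x,y)$ exists for every $(x,y)\in[a,b]\times[c,d]$, and $T$ is totally (Fréchet) differentiable at Lebesgue-almost every point of $[a,b]\times[c,d]$. -/

import Mathlib

open Set Filter Topology MeasureTheory

namespace ArzelaExample

/-- `f : [a,b] × [c,d] → ℝ` is of bounded variation in the sense of Arzelà: the sums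
`∑ |f (x_{i+1}, y_{i+1}) - f (x_i, y_i)|` over all pairs of chains
`a = x_0 ≤ x_1 ≤ ... ≤ x_m = b`, `c = y_0 ≤ y_1 ≤ ... ≤ y_m = d` are uniformly bounded.
Only the values of `f` on the rectangle matter. -/
def IsArzelaBV (f : ℝ × ℝ → ℝ) (a b c d : ℝ) : Prop :=
  ∃ M : ℝ, ∀ (m : ℕ) (x y : Fin (m + 1) → ℝ),
    Monotone x → x 0 = a → x (Fin.last m) = b →
    Monotone y → y 0 = c → y (Fin.last m) = d →
    ∑ i : Fin m, |f (x i.succ, y i.succ) - f (x i.castSucc, y i.castSucc)| ≤ M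

/-- The increasing affine map `ψ_n` of `[s_{n-1}, s_n]` onto `[s_0, s_1]`, for `n ≥ 1`. -/
noncomputable def psi (s : ℕ → ℝ) (n : ℕ) (x : ℝ) : ℝ :=
  ((s 1 - s 0) * x + s 0 * s n - s 1 * s (n - 1)) / (s n - s (n - 1))

/-- The piece `F_n` on `[s_{n-1}, s_n] × [c,d]`, for `n ≥ 1`:
`F_1 = φ` and `F_n(x,y) = (1/n) φ(ψ_n(x), y) + ((n-1)/n) φ(s_0, y)` for `n ≥ 2`. -/
noncomputable def piece (s : ℕ → ℝ) (φ : ℝ × ℝ → ℝ) (n : ℕ) (p : ℝ × ℝ) : ℝ :=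
  if n = 1 then φ p
  else 1 / (n : ℝ) * φ (psi s n p.1, p.2) + ((n : ℝ) - 1) / (n : ℝ) * φ (s 0, p.2)

open Classical in
/-- The function `T_n`, for `n ≥ 1`: it is `F_k(x,y)` if `x ∈ [s_{k-1}, s_k]`, `1 ≤ k ≤ n`
(the least such `k` is taken; by `approx_of_mem` any other choice gives the same value),
and `F_n(s_n, y)` to the right of `s_n`. -/
noncomputable def approx (s : ℕ → ℝ) (φ : ℝ × ℝ → ℝ) (n : ℕ) (p : ℝ × ℝ) : ℝ :=
  if h : ∃ k : ℕ, (1 ≤ k ∧ k ≤ n) ∧ p.1 ∈ Icc (s (k - 1)) (s k) then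
    piece s φ (Nat.find h) p
  else piece s φ n (s n, p.2)

/-- The function `T(x,y) = lim_{n → ∞} T_n(x,y)`. -/
noncomputable def limitFun (s : ℕ → ℝ) (φ : ℝ × ℝ → ℝ) (p : ℝ × ℝ) : ℝ :=
  limUnder atTop (fun n : ℕ => approx s φ n p)

/-- For the nodes `s_n = a + (b-a)/2 + ... + (b-a)/2^n = b - (b-a)/2^n`, the map `ψ_n` is
`2^n ((s_1 - s_0) x + s_0 s_n - s_1 s_{n-1}) / (b - a)`. -/
theorem psi_dyadic {a b : ℝ} (s : ℕ → ℝ)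
    (hs : ∀ n, s n = b - (b - a) / 2 ^ n) {n : ℕ} (hn : 1 ≤ n) (x : ℝ) :
    psi s n x = 2 ^ n * ((s 1 - s 0) * x + s 0 * s n - s 1 * s (n - 1)) / (b - a) := by
  obtain ⟨k, rfl⟩ : ∃ k, n = k + 1 := ⟨n - 1, by omega⟩
  have h : s (k + 1) - s (k + 1 - 1) = (b - a) / 2 ^ (k + 1) := by
    rw [Nat.add_sub_cancel, hs, hs, pow_succ]
    field_simp
    ring
  unfold psi
  rw [h, div_div_eq_mul_div, mul_comm]

theorem psi_left {s : ℕ → ℝ} (hs : StrictMono s) {n : ℕ} (hn : 1 ≤ n) :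
    psi s n (s (n - 1)) = s 0 := by
  have h : s n - s (n - 1) ≠ 0 := (sub_pos.2 (hs (by omega))).ne'
  unfold psi
  rw [div_eq_iff h]
  ring

theorem psi_right {s : ℕ → ℝ} (hs : StrictMono s) {n : ℕ} (hn : 1 ≤ n) :
    psi s n (s n) = s 1 := by
  have h : s n - s (n - 1) ≠ 0 := (sub_pos.2 (hs (by omega))).ne'
  unfold psi
  rw [div_eq_iff h]
  ring

theorem piece_left {s : ℕ → ℝ} (hs : StrictMono s) (φ : ℝ × ℝ → ℝ) {n : ℕ} (hn : 1 ≤ n) (y : ℝ) :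
    piece s φ n (s (n - 1), y) = φ (s 0, y) := by
  have hn' : (n : ℝ) ≠ 0 := by positivity
  unfold piece
  split_ifs with h
  · subst h
    rfl
  · simp only [psi_left hs hn]
    field_simp
    ring

theorem piece_right {s : ℕ → ℝ} (hs : StrictMono s) {φ : ℝ × ℝ → ℝ} {n : ℕ} (hn : 1 ≤ n) {y : ℝ}
    (hy : φ (s 0, y) = φ (s 1, y)) : piece s φ n (s n, y) = φ (s 0, y) := by
  have hn' : (n : ℝ) ≠ 0 := by positivity
  unfold piece
  split_ifs with h
  · subst h
    exact hy.symm
  · simp only [psi_right hs hn, ← hy]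
    field_simp
    ring

/-- First line of the case description of `T_n`. -/
theorem approx_of_mem {s : ℕ → ℝ} (hs : StrictMono s) {φ : ℝ × ℝ → ℝ} {n k : ℕ} (hk : 1 ≤ k)
    (hkn : k ≤ n) {x y : ℝ} (hy : φ (s 0, y) = φ (s 1, y)) (hx : x ∈ Icc (s (k - 1)) (s k)) :
    approx s φ n (x, y) = piece s φ k (x, y) := by
  classical
  have h : ∃ k : ℕ, (1 ≤ k ∧ k ≤ n) ∧ (x, y).1 ∈ Icc (s (k - 1)) (s k) := ⟨k, ⟨hk, hkn⟩, hx⟩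
  unfold approx
  rw [dif_pos h]
  have hj := Nat.find_spec h
  have hle : Nat.find h ≤ k := Nat.find_min' h ⟨⟨hk, hkn⟩, hx⟩
  generalize Nat.find h = j at hj hle
  rcases hle.eq_or_lt with rfl | hlt
  · rfl
  · have h1 : s (k - 1) ≤ s j := hx.1.trans hj.2.2
    have h2 : k - 1 = j := le_antisymm (hs.le_iff_le.1 h1) (by omega)
    have h3 : x = s j := le_antisymm hj.2.2 (h2 ▸ hx.1)
    rw [h3, piece_right hs hj.1.1 hy, ← h2, piece_left hs φ hk]

/-- Second line of the case description of `T_n`. -/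
theorem approx_of_le {s : ℕ → ℝ} (hs : StrictMono s) {φ : ℝ × ℝ → ℝ} {n : ℕ} (hn : 1 ≤ n)
    {x y : ℝ} (hy : φ (s 0, y) = φ (s 1, y)) (hx : s n ≤ x) :
    approx s φ n (x, y) = piece s φ n (s n, y) := by
  classical
  rcases hx.eq_or_lt with rfl | hlt
  · exact approx_of_mem hs hn le_rfl hy ⟨hs.monotone (by omega), le_rfl⟩
  · unfold approx
    rw [dif_neg]
    rintro ⟨k, ⟨_, hk⟩, hx'⟩
    exact absurd (hx'.2.trans (hs.monotone hk)) (not_le.2 hlt)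

end ArzelaExample

/-! Off the null set of vertical lines through `b` and the nodes, `T` agrees near each point with
one piece, so each piece may be treated alone. The supremum of sums over chains ending at `p` is a
function `V` with `|f q - f p| ≤ V q - V p` for `p ≤ q`; it is increasing. On diagonal lines `V` is
monotone in one variable, so Lebesgue's theorem and Fubini bound its diagonal difference quotients
a.e. In the sup norm, the ball of radius `r` about `p` lies between `p - (r, r)` and `p + (r, r)`,
so `f` is pointwise Lipschitz a.e., and Stepanov's theorem gives differentiability. Since `V` need
not be measurable, Fubini is applied to an upper semicontinuous regularisation of it. -/

/-! ### Stepanov's theorem by Lipschitz envelopes -/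

/-- The inf-convolution of a bounded function with `K * ‖·‖`. -/
noncomputable def infConv {E : Type*} [NormedAddCommGroup E] (f : E → ℝ) (K : ℝ) (x : E) : ℝ :=
  ⨅ z, (f z + K * ‖x - z‖)

section InfConv

variable {E : Type*} [NormedAddCommGroup E] {f : E → ℝ} {C K : ℝ}

theorem bddBelow_range_infConv (hf : ∀ x, |f x| ≤ C) (hK : 0 ≤ K) (x : E) :
    BddBelow (range fun z => f z + K * ‖x - z‖) := by
  refine ⟨-C, ?_⟩
  rintro _ ⟨z, rfl⟩
  have h1 := (abs_le.1 (hf z)).1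
  have h2 : 0 ≤ K * ‖x - z‖ := by positivity
  show -C ≤ f z + K * ‖x - z‖
  linarith

theorem infConv_le (hf : ∀ x, |f x| ≤ C) (hK : 0 ≤ K) (x : E) : infConv f K x ≤ f x :=
  (ciInf_le (bddBelow_range_infConv hf hK x) x).trans (by simp)

theorem infConv_eq (hf : ∀ x, |f x| ≤ C) (hK : 0 ≤ K) {x : E}
    (hx : ∀ z, |f z - f x| ≤ K * ‖z - x‖) : infConv f K x = f x := by
  refine le_antisymm (infConv_le hf hK x) (le_ciInf fun z => ?_)
  have h := (abs_le.1 (hx z)).1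
  rw [norm_sub_rev] at h
  linarith

theorem lipschitzWith_infConv (hf : ∀ x, |f x| ≤ C) (hK : 0 ≤ K) :
    LipschitzWith K.toNNReal (infConv f K) := by
  refine LipschitzWith.of_le_add_mul _ fun x y => ?_
  rw [Real.coe_toNNReal K hK, ← sub_le_iff_le_add]
  refine le_ciInf fun z => ?_
  have h1 : infConv f K x ≤ f z + K * ‖x - z‖ := ciInf_le (bddBelow_range_infConv hf hK x) z
  have h2 : ‖x - z‖ ≤ ‖x - y‖ + ‖y - z‖ := norm_sub_le_norm_sub_add_norm_sub x y z
  have h3 := mul_le_mul_of_nonneg_left h2 hK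
  rw [dist_eq_norm]
  linarith

end InfConv

/-- A function squeezed between two functions that are differentiable at a point, and that agree
at this point, is differentiable there. -/
theorem differentiableAt_of_squeeze {E : Type*} [NormedAddCommGroup E] [NormedSpace ℝ E]
    {u f v : E → ℝ} {x : E} (huf : ∀ z, u z ≤ f z) (hfv : ∀ z, f z ≤ v z) (hux : u x = f x)
    (hvx : v x = f x) (hu : DifferentiableAt ℝ u x) (hv : DifferentiableAt ℝ v x) :
    DifferentiableAt ℝ f x := by
  have hmin : IsLocalMin (v - u) x := Filter.Eventually.of_forall fun z => by
    simp only [Pi.sub_apply, hux, hvx, sub_self]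
    linarith [huf z, hfv z]
  have hd : HasFDerivAt (v - u) (0 : E →L[ℝ] ℝ) x := by
    have h := (hv.sub hu).hasFDerivAt
    rwa [hmin.fderiv_eq_zero] at h
  -- `0 ≤ f - u ≤ v - u`, and `v - u` is `o(‖z - x‖)`.
  have hrest : HasFDerivAt (f - u) (0 : E →L[ℝ] ℝ) x := by
    rw [hasFDerivAt_iff_isLittleO] at hd ⊢
    refine (Asymptotics.isBigO_of_le _ fun z => ?_).trans_isLittleO hd
    simp only [Pi.sub_apply, hux, hvx, sub_self, sub_zero, _root_.zero_apply,
      Real.norm_eq_abs]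
    rw [abs_of_nonneg (sub_nonneg.2 (huf z)),
      abs_of_nonneg (sub_nonneg.2 ((huf z).trans (hfv z)))]
    linarith [hfv z]
  have := (hrest.differentiableAt).add hu
  simpa using this

/-- Stepanov's theorem for bounded functions. -/
theorem ae_differentiableAt_of_pointwise_lipschitz {E : Type*} [NormedAddCommGroup E]
    [NormedSpace ℝ E] [FiniteDimensional ℝ E] [MeasurableSpace E] [BorelSpace E] (μ : Measure E)
    [μ.IsAddHaarMeasure] {f : E → ℝ} {C : ℝ} (hf : ∀ x, |f x| ≤ C)
    (hL : ∀ᵐ x ∂μ, ∃ K : ℝ, ∀ z, |f z - f x| ≤ K * ‖z - x‖) :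
    ∀ᵐ x ∂μ, DifferentiableAt ℝ f x := by
  have hf' : ∀ x, |(-f) x| ≤ C := fun x => by simpa using hf x
  have h1 : ∀ᵐ x ∂μ, ∀ n : ℕ, DifferentiableAt ℝ (infConv f n) x :=
    ae_all_iff.2 fun n => (lipschitzWith_infConv hf n.cast_nonneg).ae_differentiableAt
  have h2 : ∀ᵐ x ∂μ, ∀ n : ℕ, DifferentiableAt ℝ (infConv (-f) n) x :=
    ae_all_iff.2 fun n => (lipschitzWith_infConv hf' n.cast_nonneg).ae_differentiableAt
  filter_upwards [h1, h2, hL] with x hx1 hx2 ⟨K, hK⟩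
  -- Integer constants suffice, so only countably many null sets are discarded.
  obtain ⟨n, hn⟩ := exists_nat_ge K
  have hLip : ∀ z, |f z - f x| ≤ n * ‖z - x‖ := fun z =>
    (hK z).trans (mul_le_mul_of_nonneg_right hn (norm_nonneg _))
  have hLip' : ∀ z, |(-f) z - (-f) x| ≤ n * ‖z - x‖ := fun z => by
    rw [Pi.neg_apply, Pi.neg_apply, ← abs_neg]
    convert hLip z using 2
    ring
  refine differentiableAt_of_squeeze (infConv_le hf n.cast_nonneg) (v := -infConv (-f) n)
    (fun z => ?_) (infConv_eq hf n.cast_nonneg hLip) ?_ (hx1 n) (hx2 n).neg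
  · have := infConv_le hf' (n.cast_nonneg (α := ℝ)) z
    simp only [Pi.neg_apply] at this ⊢
    linarith
  · rw [Pi.neg_apply, infConv_eq hf' n.cast_nonneg hLip', Pi.neg_apply, neg_neg]

/-! ### Monotone functions along diagonals -/

/-- The regularisation from above of a function on the plane along the diagonal. -/
noncomputable def diagReg (V : ℝ × ℝ → ℝ) (p : ℝ × ℝ) : ℝ :=
  ⨅ r : Ioi (0 : ℝ), V (p + ((r : ℝ), (r : ℝ)))

section DiagReg

variable {V : ℝ × ℝ → ℝ}

theorem le_diagReg (hV : Monotone V) (p : ℝ × ℝ) : V p ≤ diagReg V p :=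
  have : Nonempty (Ioi (0 : ℝ)) := ⟨⟨1, mem_Ioi.2 one_pos⟩⟩
  le_ciInf fun r => hV (le_add_of_nonneg_right ⟨r.2.le, r.2.le⟩)

theorem diagReg_le (hV : Monotone V) (p : ℝ × ℝ) {r : ℝ} (hr : 0 < r) :
    diagReg V p ≤ V (p + (r, r)) := by
  refine ciInf_le (f := fun r : Ioi (0 : ℝ) => V (p + ((r : ℝ), (r : ℝ)))) ⟨V p, ?_⟩ ⟨r, hr⟩
  rintro _ ⟨r, rfl⟩
  exact hV (le_add_of_nonneg_right ⟨r.2.le, r.2.le⟩)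

theorem monotone_diagReg (hV : Monotone V) : Monotone (diagReg V) := fun p q hpq =>
  have : Nonempty (Ioi (0 : ℝ)) := ⟨⟨1, mem_Ioi.2 one_pos⟩⟩
  le_ciInf fun r => (diagReg_le hV p r.2).trans (hV (by gcongr))

theorem upperSemicontinuous_diagReg (hV : Monotone V) : UpperSemicontinuous (diagReg V) := by
  intro p c hc
  have : Nonempty (Ioi (0 : ℝ)) := ⟨⟨1, mem_Ioi.2 one_pos⟩⟩
  obtain ⟨⟨r, hr⟩, hrc⟩ := exists_lt_of_ciInf_lt hc
  have hr2 : 0 < r / 2 := half_pos hr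
  filter_upwards [Metric.closedBall_mem_nhds p hr2] with q hq
  refine (diagReg_le hV q hr2).trans_lt (lt_of_le_of_lt (hV ?_) hrc)
  rw [Metric.mem_closedBall, dist_eq_norm, norm_prod_le_iff] at hq
  have h1 := (abs_le.1 hq.1).2
  have h2 := (abs_le.1 hq.2).2
  simp only [Prod.fst_sub, Prod.snd_sub] at h1 h2
  exact ⟨show q.1 + r / 2 ≤ p.1 + r by linarith, show q.2 + r / 2 ≤ p.2 + r by linarith⟩

end DiagReg

/-- The central difference quotients along the diagonal of a measurable monotone function on the
plane are bounded at almost every point. -/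
theorem ae_diagonal_difference_le {W : ℝ × ℝ → ℝ} (hW : Monotone W) (hWm : Measurable W) :
    ∀ᵐ p : ℝ × ℝ, ∃ K N : ℕ, ∀ m : ℕ, N ≤ m →
      W (p + ((m : ℝ)⁻¹, (m : ℝ)⁻¹)) - W (p - ((m : ℝ)⁻¹, (m : ℝ)⁻¹)) ≤ K * (m : ℝ)⁻¹ := by
  -- Natural `K`, `N` and radii `1/m` keep this set a countable combination of measurable sets.
  have hmeas : MeasurableSet {p : ℝ × ℝ | ∃ K N : ℕ, ∀ m : ℕ, N ≤ m →
      W (p + ((m : ℝ)⁻¹, (m : ℝ)⁻¹)) - W (p - ((m : ℝ)⁻¹, (m : ℝ)⁻¹)) ≤ K * (m : ℝ)⁻¹} := by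
    simp only [ofPred_exists, ofPred_forall]
    refine MeasurableSet.iUnion fun K => MeasurableSet.iUnion fun N => MeasurableSet.iInter fun m =>
      MeasurableSet.iInter fun _ => measurableSet_le ?_ measurable_const
    exact (hWm.comp (measurable_id.add_const _)).sub (hWm.comp (measurable_id.sub_const _))
  -- The shear `(u, t) ↦ (t, t + u)` turns fibres into diagonal lines.
  have hmp := measurePreserving_prod_add_swap (volume : Measure ℝ) (volume : Measure ℝ)
  rw [Measure.volume_eq_prod, ← hmp.map_eq, ae_map_iff hmp.measurable.aemeasurable hmeas]
  refine (Measure.ae_prod_iff_ae_ae (hmp.measurable hmeas)).2 ?_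
  refine Filter.Eventually.of_forall fun u => ?_
  have hg : Monotone fun t : ℝ => W (t, t + u) := fun t t' h =>
    hW ⟨h, show t + u ≤ t' + u by linarith⟩
  filter_upwards [hg.ae_differentiableAt] with t ht
  obtain ⟨K, hK⟩ := ht.isBigO_sub.bound
  obtain ⟨ε, hε, hball⟩ := Metric.eventually_nhds_iff.1 hK
  obtain ⟨k, hk⟩ := exists_nat_ge (2 * K)
  obtain ⟨N, hN⟩ := exists_nat_gt ε⁻¹
  refine ⟨k, N, fun m hm => ?_⟩
  have hNpos : (0 : ℝ) < N := (inv_pos.2 hε).trans hN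
  have hNm : (N : ℝ) ≤ m := Nat.cast_le.2 hm
  have hmpos : (0 : ℝ) < m := hNpos.trans_le hNm
  have hr : (0 : ℝ) < (m : ℝ)⁻¹ := inv_pos.2 hmpos
  have hrε : (m : ℝ)⁻¹ < ε := inv_lt_of_inv_lt₀ hε (hN.trans_le hNm)
  generalize (m : ℝ)⁻¹ = r at hr hrε ⊢
  have h1 := @hball (t + r) (by simpa [abs_of_pos hr] using hrε)
  have h2 := @hball (t - r) (by simpa [abs_of_pos hr] using hrε)
  simp only [add_sub_cancel_left, sub_sub_cancel_left, norm_neg, Real.norm_eq_abs,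
    abs_of_pos hr] at h1 h2
  have h3 := (abs_le.1 h1).2
  have h4 := (abs_le.1 h2).1
  have h5 : ((t, t + u) + (r, r) : ℝ × ℝ) = (t + r, t + r + u) := by ext <;> simp; ring
  have h6 : ((t, t + u) - (r, r) : ℝ × ℝ) = (t - r, t - r + u) := by ext <;> simp; ring
  rw [h5, h6]
  have h7 := mul_le_mul_of_nonneg_right hk hr.le
  linarith

/-- A function on the plane whose increments along the coordinatewise order are controlled by those
of a monotone function is almost everywhere totally differentiable. -/
theorem ae_differentiableAt_of_abs_sub_le {f V : ℝ × ℝ → ℝ} {C : ℝ} (hf : ∀ p, |f p| ≤ C)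
    (hfV : ∀ p q, p ≤ q → |f q - f p| ≤ V q - V p) : ∀ᵐ p : ℝ × ℝ, DifferentiableAt ℝ f p := by
  have hV : Monotone V := fun p q h => by linarith [(abs_nonneg _).trans (hfV p q h)]
  have hW := monotone_diagReg hV
  refine ae_differentiableAt_of_pointwise_lipschitz volume hf ?_
  filter_upwards [ae_diagonal_difference_le hW (upperSemicontinuous_diagReg hV).measurable]
    with p ⟨K, N, hKN⟩
  have hC : 0 ≤ C := (abs_nonneg _).trans (hf p)
  -- With `m = ⌊1/(2r)⌋`: if `m > N`, then `2r ≤ 1/m ≤ 4r`, and two increments of at most `K/m` give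
  -- `8Kr`. Otherwise `1 ≤ 2(N + 1)r`, and `2C` is at most `4C(N + 1)r`.
  refine ⟨8 * K + 4 * C * (N + 1), fun z => ?_⟩
  rcases (norm_nonneg (z - p)).eq_or_lt with h0 | hr
  · rw [sub_eq_zero.1 (norm_eq_zero.1 h0.symm)]
    simp
  have hz : ‖z - p‖ ≤ ‖z - p‖ := le_rfl
  rw [norm_prod_le_iff] at hz
  obtain ⟨hz1, hz2⟩ := hz
  generalize ‖z - p‖ = r at hr hz1 hz2 ⊢
  have h1 := abs_le.1 hz1
  have h2 := abs_le.1 hz2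
  simp only [Prod.fst_sub, Prod.snd_sub] at h1 h2
  have hKr : 0 ≤ (K : ℝ) * r := by positivity
  have hCr : 0 ≤ 4 * C * (N + 1) * r := by positivity
  have hfl : (⌊(2 * r)⁻¹⌋₊ : ℝ) ≤ (2 * r)⁻¹ := Nat.floor_le (by positivity)
  have hfl' := Nat.lt_floor_add_one (2 * r)⁻¹
  generalize ⌊(2 * r)⁻¹⌋₊ = m at hfl hfl'
  have hmr : (m : ℝ) * (2 * r) ≤ 1 := by rwa [← le_div_iff₀ (by positivity), one_div]
  have hmr' : 1 < ((m : ℝ) + 1) * (2 * r) := by rwa [← div_lt_iff₀ (by positivity), one_div]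
  by_cases hm : N + 1 ≤ m
  · have hm1 : (1 : ℝ) ≤ m := by exact_mod_cast (by omega : 1 ≤ m)
    have hdiff := hKN m (by omega)
    have hm2 : 2 * r ≤ (m : ℝ)⁻¹ := by
      rw [← one_div, le_div_iff₀ (by linarith)]
      linarith
    have hm4 : (m : ℝ)⁻¹ ≤ 4 * r := by
      rw [← one_div, div_le_iff₀ (by linarith)]
      nlinarith
    generalize (m : ℝ)⁻¹ = ρ at hdiff hm2 hm4
    -- Passing from `V` to its regularisation costs a shift by `r` below; `ρ ≥ 2r` leaves room for
    -- it.
    have hup : V (p + (r, r)) ≤ diagReg V (p + (ρ, ρ)) := (le_diagReg hV _).trans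
      (hW (add_le_add_right (Prod.mk_le_mk.2 ⟨by linarith, by linarith⟩) p))
    have hlow : diagReg V (p - (ρ, ρ)) ≤ V (p - (r, r)) := by
      refine (diagReg_le hV _ hr).trans (hV ⟨?_, ?_⟩)
      · show p.1 - ρ + r ≤ p.1 - r
        linarith
      · show p.2 - ρ + r ≤ p.2 - r
        linarith
    have ha := hfV (p - (r, r)) z
      ⟨show p.1 - r ≤ z.1 by linarith, show p.2 - r ≤ z.2 by linarith⟩
    have hb := hfV (p - (r, r)) p
      ⟨show p.1 - r ≤ p.1 by linarith, show p.2 - r ≤ p.2 by linarith⟩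
    have hzV : V z ≤ V (p + (r, r)) :=
      hV ⟨show z.1 ≤ p.1 + r by linarith, show z.2 ≤ p.2 + r by linarith⟩
    have hpV : V p ≤ V (p + (r, r)) :=
      hV ⟨show p.1 ≤ p.1 + r by linarith, show p.2 ≤ p.2 + r by linarith⟩
    -- `z` and `p` may be incomparable, but both dominate `p - (r, r)`.
    have htri := abs_sub_le (f z) (f (p - (r, r))) (f p)
    rw [abs_sub_comm (f (p - (r, r)))] at htri
    have hKρ := mul_le_mul_of_nonneg_left hm4 (K.cast_nonneg (α := ℝ))
    linarith
  · have hmN : (m : ℝ) + 1 ≤ N + 1 := by exact_mod_cast (by omega : m + 1 ≤ N + 1)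
    have h3 : |f z - f p| ≤ 2 * C := by
      have := abs_sub (f z) (f p)
      linarith [hf z, hf p]
    have h4 : 1 ≤ (N + 1) * (2 * r) := hmr'.le.trans (by gcongr)
    have h5 := mul_le_mul_of_nonneg_left h4 hC
    linarith

/-! ### The variation function -/

/-- The sums over the chains from `(a, c)` to `p`. -/
def chainSums (f : ℝ × ℝ → ℝ) (a c : ℝ) (p : ℝ × ℝ) : Set ℝ :=
  {v | ∃ (m : ℕ) (z : ℕ → ℝ × ℝ), Monotone z ∧ z 0 = (a, c) ∧ z m = p ∧
    v = ∑ i ∈ Finset.range m, |f (z (i + 1)) - f (z i)|}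

/-- Append `q` to the chain; the sequence stays at `q` from then on. -/
theorem chainSums_add {f : ℝ × ℝ → ℝ} {a c : ℝ} {p q : ℝ × ℝ} (hpq : p ≤ q) {v : ℝ}
    (hv : v ∈ chainSums f a c p) : v + |f q - f p| ∈ chainSums f a c q := by
  obtain ⟨m, z, hz, hz0, hzm, rfl⟩ := hv
  refine ⟨m + 1, fun i => if i ≤ m then z i else q, fun i j hij => ?_, by simpa using hz0,
    by simp, ?_⟩
  · show (if i ≤ m then z i else q) ≤ if j ≤ m then z j else q
    split_ifs with h1 h2 h2
    · exact hz hij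
    · exact (hz h1).trans (hzm.trans_le hpq)
    · omega
    · exact le_rfl
  · rw [Finset.sum_range_succ]
    congr 1
    · refine Finset.sum_congr rfl fun i hi => ?_
      have hi' := Finset.mem_range.1 hi
      simp [hi'.le, Nat.succ_le_of_lt hi']
    · simp [hzm]

namespace ArzelaExample

/-- The increments of a function of bounded variation in the sense of Arzelà are controlled by those
of a monotone function. -/
theorem IsArzelaBV.exists_abs_sub_le {f : ℝ × ℝ → ℝ} {a b c d : ℝ}
    (hf : IsArzelaBV f a b c d) :
    ∃ V : ℝ × ℝ → ℝ, ∀ p q, (a, c) ≤ p → p ≤ q → q ≤ (b, d) → |f q - f p| ≤ V q - V p := by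
  obtain ⟨M, hM⟩ := hf
  have hcorner : ∀ v ∈ chainSums f a c (b, d), v ≤ M := by
    rintro _ ⟨m, z, hz, hz0, hzm, rfl⟩
    have h := hM m (fun i => (z i).1) (fun i => (z i).2) (fun i j hij => (hz hij).1)
      (by simp [hz0]) (by simp [hzm]) (fun i j hij => (hz hij).2) (by simp [hz0]) (by simp [hzm])
    rw [Finset.sum_range]
    simpa using h
  -- `M` bounds only chains reaching the far corner, so each chain is prolonged to it.
  have hbdd : ∀ p, p ≤ (b, d) → BddAbove (chainSums f a c p) := fun p hp =>
    ⟨M, fun v hv => (le_add_of_nonneg_right (abs_nonneg _)).trans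
      (hcorner _ (chainSums_add hp hv))⟩
  have hne : ∀ p, (a, c) ≤ p → (chainSums f a c p).Nonempty := fun p hp =>
    ⟨_, chainSums_add hp (v := 0) ⟨0, fun _ => (a, c), monotone_const, rfl, rfl, by simp⟩⟩
  refine ⟨fun p => sSup (chainSums f a c p), fun p q hp hpq hq => ?_⟩
  rw [le_sub_comm]
  exact csSup_le (hne p hp) fun v hv =>
    le_sub_iff_add_le.2 (le_csSup (hbdd q hq) (chainSums_add hpq hv))

/-! ### The pieces and their limit -/

variable {s : ℕ → ℝ} {φ : ℝ × ℝ → ℝ}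

/-- For `n = 1`, `psi` is the identity and the second weight vanishes. -/
theorem piece_eq (hs : StrictMono s) {n : ℕ} (p : ℝ × ℝ) :
    piece s φ n p = 1 / (n : ℝ) * φ (psi s n p.1, p.2) + ((n : ℝ) - 1) / n * φ (s 0, p.2) := by
  unfold piece
  split_ifs with h
  · subst h
    have h1 : psi s 1 p.1 = p.1 := by
      have : s 1 - s 0 ≠ 0 := (sub_pos.2 (hs one_pos)).ne'
      simp only [psi, Nat.sub_self]
      rw [div_eq_iff this]
      ring
    simp [h1]
  · rfl

theorem monotone_psi (hs : StrictMono s) {n : ℕ} (hn : 1 ≤ n) : Monotone (psi s n) := by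
  intro x y hxy
  have h1 : 0 < s n - s (n - 1) := sub_pos.2 (hs (by omega))
  have h2 : 0 < s 1 - s 0 := sub_pos.2 (hs one_pos)
  unfold psi
  gcongr

/-- Clamping to the rectangle is monotone, so it extends the increment bound to the whole plane. The
bound survives monotone substitutions and nonnegative combinations, hence passes from `φ` to the
piece. -/
theorem ae_differentiableAt_extension (hs : StrictMono s) {c d : ℝ} (hcd : c ≤ d)
    (hBV : IsArzelaBV φ (s 0) (s 1) c d) {n : ℕ} (hn : 1 ≤ n) :
    ∃ g : ℝ × ℝ → ℝ, (∀ p ∈ Icc (s (n - 1)) (s n) ×ˢ Icc c d, g p = piece s φ n p) ∧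
      ∀ᵐ p, DifferentiableAt ℝ g p := by
  have h01 : s 0 ≤ s 1 := hs.monotone (Nat.zero_le 1)
  obtain ⟨V, hV⟩ := hBV.exists_abs_sub_le
  have hcorner : ((s 0, c) : ℝ × ℝ) ≤ (s 1, d) := ⟨h01, hcd⟩
  let π : ℝ × ℝ → ℝ × ℝ := fun p => (s 0, c) ⊔ ((s 1, d) ⊓ p)
  have hπ : Monotone π := fun p q h => sup_le_sup_left (inf_le_inf_left _ h) _
  have hπl : ∀ p, (s 0, c) ≤ π p := fun p => le_sup_left
  have hπr : ∀ p, π p ≤ (s 1, d) := fun p => sup_le hcorner inf_le_left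
  have hπid : ∀ p, (s 0, c) ≤ p → p ≤ (s 1, d) → π p = p := fun p h1 h2 => by
    simp only [π, inf_eq_right.2 h2, sup_eq_right.2 h1]
  have hinc : ∀ p q, p ≤ q → |φ (π q) - φ (π p)| ≤ V (π q) - V (π p) := fun p q h =>
    hV _ _ (hπl p) (hπ h) (hπr q)
  have hbound : ∀ p, |φ (π p)| ≤ |φ (s 0, c)| + (V (s 1, d) - V (s 0, c)) := fun p => by
    have h1 := hV (s 0, c) (π p) le_rfl (hπl p) (hπr p)
    have h2 := (abs_nonneg _).trans (hV (π p) (s 1, d) (hπl p) (hπr p) le_rfl)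
    have h3 := abs_sub_abs_le_abs_sub (φ (π p)) (φ (s 0, c))
    linarith
  have hn1 : (1 : ℝ) ≤ n := by exact_mod_cast hn
  have hα : 0 ≤ 1 / (n : ℝ) := by positivity
  have hβ : 0 ≤ ((n : ℝ) - 1) / n := div_nonneg (by linarith) (by linarith)
  have hαβ : ∀ u v A B : ℝ, |u| ≤ A → |v| ≤ B →
      |1 / (n : ℝ) * u + ((n : ℝ) - 1) / n * v| ≤
        1 / (n : ℝ) * A + ((n : ℝ) - 1) / n * B := fun u v A B hu hv => by
    refine (abs_add_le _ _).trans ?_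
    rw [abs_mul, abs_mul, abs_of_nonneg hα, abs_of_nonneg hβ]
    gcongr
  refine ⟨fun p => 1 / (n : ℝ) * φ (π (psi s n p.1, p.2)) + ((n : ℝ) - 1) / n * φ (π (s 0, p.2)),
    fun p hp => ?_, ae_differentiableAt_of_abs_sub_le (V := fun p =>
      1 / (n : ℝ) * V (π (psi s n p.1, p.2)) + ((n : ℝ) - 1) / n * V (π (s 0, p.2)))
      (fun p => hαβ _ _ _ _ (hbound _) (hbound _)) fun p q hpq => ?_⟩
  · obtain ⟨⟨h1, h2⟩, h3, h4⟩ := hp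
    have h5 := monotone_psi hs hn h1
    have h6 := monotone_psi hs hn h2
    rw [psi_left hs hn] at h5
    rw [psi_right hs hn] at h6
    beta_reduce
    rw [piece_eq hs, hπid (psi s n p.1, p.2) ⟨h5, h3⟩ ⟨h6, h4⟩,
      hπid (s 0, p.2) ⟨le_rfl, h3⟩ ⟨h01, h4⟩]
  · have h := hαβ _ _ _ _
      (hinc (psi s n p.1, p.2) (psi s n q.1, q.2) ⟨monotone_psi hs hn hpq.1, hpq.2⟩)
      (hinc (s 0, p.2) (s 0, q.2) ⟨le_rfl, hpq.2⟩)
    convert h using 1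
    · congr 1
      ring
    · ring

theorem tendsto_approx_of_mem (hs : StrictMono s) {k : ℕ} (hk : 1 ≤ k) {p : ℝ × ℝ}
    (hy : φ (s 0, p.2) = φ (s 1, p.2)) (hx : p.1 ∈ Icc (s (k - 1)) (s k)) :
    Tendsto (fun n => approx s φ n p) atTop (𝓝 (piece s φ k p)) :=
  tendsto_const_nhds.congr' <| (eventually_ge_atTop k).mono fun _ hn =>
    (approx_of_mem hs hk hn hy hx).symm

theorem exists_mem_Icc (hs : StrictMono s) {b x : ℝ} (hsb : Tendsto s atTop (𝓝 b))
    (hx : s 0 ≤ x) (hxb : x < b) : ∃ k, 1 ≤ k ∧ x ∈ Icc (s (k - 1)) (s k) := by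
  classical
  have h : ∃ k, x ≤ s k := ((hsb.eventually_const_lt hxb).exists).imp fun _ h => h.le
  have hmin : ∀ j < Nat.find h, s j < x := fun j hj => not_le.1 (Nat.find_min h hj)
  have hle := Nat.find_spec h
  generalize Nat.find h = k at hmin hle
  -- `k = 0` forces `x = s 0`, which lies in the first interval.
  rcases Nat.eq_zero_or_pos k with rfl | hk
  · exact ⟨1, le_rfl, hx, hle.trans (hs.monotone (Nat.zero_le 1))⟩
  · exact ⟨k, hk, (hmin _ (by omega)).le, hle⟩

theorem exists_tendsto_approx (hs : StrictMono s) {b : ℝ} (hsb : Tendsto s atTop (𝓝 b))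
    {p : ℝ × ℝ} (hy : φ (s 0, p.2) = φ (s 1, p.2)) (hx : p.1 ∈ Icc (s 0) b) :
    ∃ l, Tendsto (fun n => approx s φ n p) atTop (𝓝 l) := by
  rcases hx.2.lt_or_eq with hlt | heq
  · obtain ⟨k, hk, hxk⟩ := exists_mem_Icc hs hsb hx.1 hlt
    exact ⟨_, tendsto_approx_of_mem hs hk hy hxk⟩
  -- At `x = b` every approximant takes the node value `φ (s 0, y)`.
  · refine ⟨φ (s 0, p.2), tendsto_const_nhds.congr' <| (eventually_ge_atTop 1).mono fun n hn => ?_⟩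
    have hsn : s n ≤ p.1 := heq ▸ hs.monotone.ge_of_tendsto hsb n
    exact ((approx_of_le hs hn hy hsn).trans (piece_right hs hn hy)).symm

end ArzelaExample

theorem mainTheorem12 (a b c d : ℝ) (hcd : c < d)
    (s : ℕ → ℝ) (hs : StrictMono s) (hs0 : s 0 = a) (hsb : Tendsto s atTop (𝓝 b))
    (φ : ℝ × ℝ → ℝ) (hφ : ContinuousOn φ (Icc (s 0) (s 1) ×ˢ Icc c d))
    (hφ01 : ∀ y ∈ Icc c d, φ (s 0, y) = φ (s 1, y))
    (hBV : ArzelaExample.IsArzelaBV φ (s 0) (s 1) c d) :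
    (∀ p ∈ Icc a b ×ˢ Icc c d,
      Tendsto (fun n : ℕ => ArzelaExample.approx s φ n p) atTop
        (𝓝 (ArzelaExample.limitFun s φ p))) ∧
    ∀ᵐ p ∂(volume.restrict (Icc a b ×ˢ Icc c d)),
      DifferentiableWithinAt ℝ (ArzelaExample.limitFun s φ) (Icc a b ×ˢ Icc c d) p := by
  subst hs0
  refine ⟨fun p hp => tendsto_nhds_limUnder
    (ArzelaExample.exists_tendsto_approx hs hsb (hφ01 _ hp.2) hp.1), ?_⟩
  choose g hgeq hgdiff using fun n : ℕ =>
    ArzelaExample.ae_differentiableAt_extension hs hcd.le hBV (Nat.le_add_left 1 n)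
  have hnodes : ∀ᵐ p : ℝ × ℝ, p.1 ∉ insert b (range s) :=
    Measure.quasiMeasurePreserving_fst.ae
      (((countable_range s).insert b).ae_notMem (volume : Measure ℝ))
  rw [ae_restrict_iff' (measurableSet_Icc.prod measurableSet_Icc)]
  filter_upwards [ae_all_iff.2 hgdiff, hnodes] with p hp hpn hpR
  simp only [mem_insert_iff, mem_range, not_or, not_exists] at hpn
  obtain ⟨k, hk, hxk⟩ :=
    ArzelaExample.exists_mem_Icc hs hsb hpR.1.1 (lt_of_le_of_ne hpR.1.2 hpn.1)
  obtain ⟨n, rfl⟩ : ∃ n, k = n + 1 := ⟨k - 1, by omega⟩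
  have heq : ∀ q ∈ Icc (s 0) b ×ˢ Icc c d, q.1 ∈ Icc (s (n + 1 - 1)) (s (n + 1)) →
      ArzelaExample.limitFun s φ q = g n q := fun q hq hqn =>
    (ArzelaExample.tendsto_approx_of_mem hs hk (hφ01 _ hq.2) hqn).limUnder_eq.trans
      (hgeq n q ⟨hqn, hq.2⟩).symm
  -- Off the nodes `p.1` is interior to its interval, so one piece describes `T` near `p`.
  have hnhds : ∀ᶠ q : ℝ × ℝ in 𝓝 p, q.1 ∈ Icc (s (n + 1 - 1)) (s (n + 1)) :=
    continuous_fst.continuousAt.eventually (Icc_mem_nhds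
      (lt_of_le_of_ne hxk.1 (hpn.2 _)) (lt_of_le_of_ne hxk.2 (Ne.symm (hpn.2 _))))
  refine (hp n).differentiableWithinAt.congr_of_eventuallyEq ?_ (heq p hpR hxk)
  filter_upwards [self_mem_nhdsWithin, nhdsWithin_le_nhds hnhds] with q hq hqn
  exact heq q hq hqn
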